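/- **Proposition (quaternionic Wishart matrices).** Notation. *Quaternions.* For $q=a+bi+cj+dk\in\mathbb{H}$ and $\eta,\theta\in\{1,-1\}$ let $q_{\eta\theta}$ be the entry of $\begin{pmatrix}a+bi&c+di\\-c+di&a-bi\end{pmatrix}$ in row $\eta$ and column $\theta$, where rows and columns are indexed by $1,-1$ in this order. For a quaternionic matrix $A$ write $A_{\iota\kappa;\eta\theta}:=(A_{\iota\kappa})_{\eta\theta}$, and let $A^*$ be its conjugate transpose. A standard quaternionic Gaussian is $\xi_0+i\xi_1+j\xi_2+k\xi_3$ with independent $\xi_a\sim N(0,\tfrac14)$. *Permutations.* Let $[n]=\{1,\dots,n\}$, $\pm[n]=[n]\cup(-[n])$, $\delta(k)=-k$, and let $\mathrm{sgn}(k)$ be the sign of $k$. $\mathrm{PM}(n)$ is the set of permutations $\alpha$ of $\pm[n]$ such that $\delta\alpha\delta=\alpha^{-1}$ and such that $k$ and $-k$ never lie in the same cycle of $\alpha$. $\#(\alpha)$ is the number of cycles of $\alpha$, fixed points included; it is even for $\alpha\in\mathrm{PM}(n)$. $\mathrm{FD}(\alpha)$ is the union of those cycles of $\alpha$ whose element of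 smallest absolute value is positive, and also denotes the restriction of $\alpha$ to this set; thus $\#(\mathrm{FD}(\alpha))=\#(\alpha)/2$ for $\alpha\in\mathrm{PM}(n)$. *Traces.* Fix $M,N\ge 0$. For $\pi\in\mathrm{PM}(n)$ and $M\times M$ quaternionic matrices $A_1,\dots,A_n$, put $A^{(k)}=A_k$ and $A^{(-k)}=A_k^*$ for $k\in[n]$, and $$\mathrm{Re}_{\mathrm{FD}(\pi)}\mathrm{tr}_{\mathrm{FD}(\pi)}(A_1,\dots,A_n):=2^{-\#(\mathrm{FD}(\pi))}N^{-\#(\mathrm{FD}(\pi))}\sum_{\substack{i:\mathrm{FD}(\pi)\to[M]\\h:\mathrm{FD}(\pi)\to\{1,-1\}}}\ \prod_{k\in\mathrm{FD}(\pi)}A^{(k)}_{i_k,i_{\pi(k)};h_k,h_{\pi(k)}}$$ (each trace is normalized by $1/N$, also when $M\ne N$). *Statement.* Let $G$ be an $M\times N$ random matrix whose entries are independent standard quaternionic Gaussians, let $D_1,\dots,D_n$ be deterministic $M\times M$ quaternionic matrices, and let $W_k=\frac1N G^*D_kG$ for $k\in[n]$, all with the same $G$. Then for all $\iota:\pm[n]\to[N]$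 and $\eta:\pm[n]\to\{1,-1\}$ the product $\prod_{k=1}^n (W_k)_{\iota_k\iota_{-k};\eta_k\eta_{-k}}$ is integrable and $$\mathbb{E}\Bigl(\prod_{k=1}^n (W_k)_{\iota_k\iota_{-k};\eta_k\eta_{-k}}\Bigr)=\sum_{\alpha}(2N)^{\#(\alpha)/2-n}\Bigl[\prod_{\substack{k\in[n]\\-k\in\mathrm{FD}(\alpha)}}\eta_k\eta_{-k}\Bigr]f(\alpha),$$ where $\alpha$ runs over the elements of $\mathrm{PM}(n)$ such that, for all $k\in\pm[n]$, $\iota_k=\iota_{-\alpha(k)}$ and $\mathrm{sgn}(k)\,\eta_k=\mathrm{sgn}(\alpha(k))\,\eta_{-\alpha(k)}$, and $$f(\alpha)=\mathrm{Re}_{\mathrm{FD}(\alpha^{-1})}\mathrm{tr}_{\mathrm{FD}(\alpha^{-1})}(D_1,\dots,D_n).$$ -/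

import Mathlib

open scoped Quaternion

namespace QWishart

open MeasureTheory ProbabilityTheory

/-! ### The index set `±[n]` and permutations of it -/

/-- The set `±[n] = {1, …, n} ∪ {-1, …, -n}`: the pair `(i, s)` stands for the integer
`s * (i + 1)`. -/
abbrev SignedIdx (n : ℕ) : Type := Fin n × ℤˣ

/-- The sign of an element of `±[n]`. -/
def sgn {n : ℕ} (k : SignedIdx n) : ℤˣ := k.2

/-- The map `δ : k ↦ -k` on `±[n]`. -/
def delta (n : ℕ) : Equiv.Perm (SignedIdx n) where
  toFun k := (k.1, -k.2)
  invFun k := (k.1, -k.2)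
  left_inv k := by simp
  right_inv k := by simp

/-- `PM(n)`: the permutations `π` of `±[n]` with `δ π δ = π⁻¹` such that `k` and `-k` never lie in
the same cycle. -/
def PM (n : ℕ) : Finset (Equiv.Perm (SignedIdx n)) :=
  Finset.univ.filter fun π =>
    delta n * π * delta n = π⁻¹ ∧ ∀ k, ¬ π.SameCycle k (delta n k)

/-- `#(π)`: the number of cycles (orbits) of `π`, fixed points included. -/
noncomputable def numCycles {α : Type*} (π : Equiv.Perm α) : ℕ :=
  Nat.card (Quotient (Equiv.Perm.SameCycle.setoid π))

/-- `FD(π)` as a set: the union of those cycles of `π` whose element of smallest absolute value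
is positive. -/
def FD {n : ℕ} (π : Equiv.Perm (SignedIdx n)) : Finset (SignedIdx n) :=
  Finset.univ.filter fun k =>
    ∃ j, π.SameCycle k j ∧ sgn j = 1 ∧ ∀ l, π.SameCycle k l → j.1 ≤ l.1

theorem apply_mem_FD {n : ℕ} (π : Equiv.Perm (SignedIdx n)) (k : SignedIdx n) :
    π k ∈ FD π ↔ k ∈ FD π := by
  simp only [FD, Finset.mem_filter, Finset.mem_univ, true_and, Equiv.Perm.sameCycle_apply_left]

/-- `FD(π)` as a permutation: the restriction of `π` to the set `FD(π)`. -/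
def FDPerm {n : ℕ} (π : Equiv.Perm (SignedIdx n)) : Equiv.Perm {k // k ∈ FD π} :=
  π.subtypePerm (apply_mem_FD π)

/-! ### Quaternions and quaternionic matrices -/

/-- The entry `[q]_{η θ}` of the matrix `!![a+bi, c+di; -c+di, a-bi]` representing the quaternion
`q = a + bi + cj + dk`; rows and columns are indexed by `1` and `-1`, in this order. -/
def qEntry (q : ℍ[ℝ]) (η θ : ℤˣ) : ℂ :=
  if η = 1 then
    if θ = 1 then ⟨q.re, q.imI⟩ else ⟨q.imJ, q.imK⟩
  else
    if θ = 1 then ⟨-q.imJ, q.imK⟩ else ⟨q.re, -q.imI⟩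

/-- `A^{(k)}` for `k ∈ ±[n]`: the matrix `A_k` for `k > 0`, and the adjoint `A_{|k|}^*` for
`k < 0`. -/
def signedMatrix {n M : ℕ} (A : Fin n → Matrix (Fin M) (Fin M) ℍ[ℝ]) (k : SignedIdx n) :
    Matrix (Fin M) (Fin M) ℍ[ℝ] :=
  if sgn k = 1 then A k.1 else (A k.1).conjTranspose

/-- `Re_{FD(π)} tr_{FD(π)} (A_1, …, A_n)`, i.e.
`2^{-#(FD π)} N^{-#(FD π)} ∑_{i, h} ∏_{k ∈ FD π} A^{(k)}_{i_k, i_{π k}; h_k, h_{π k}}`,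
where `i : FD π → [M]` and `h : FD π → {1, -1}`. The matrices are `M × M`, and each trace is
normalized by the parameter `N`. -/
noncomputable def reTr (N : ℕ) {n M : ℕ} (π : Equiv.Perm (SignedIdx n))
    (A : Fin n → Matrix (Fin M) (Fin M) ℍ[ℝ]) : ℂ :=
  ((2 : ℂ) ^ numCycles (FDPerm π))⁻¹ * ((N : ℂ) ^ numCycles (FDPerm π))⁻¹ *
    ∑ i : {k // k ∈ FD π} → Fin M, ∑ h : {k // k ∈ FD π} → ℤˣ,
      ∏ k : {k // k ∈ FD π},
        qEntry (signedMatrix A k (i k) (i (FDPerm π k))) (h k) (h (FDPerm π k))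

/-! ### Gaussian matrices -/

/-- `X` is a standard quaternionic Gaussian random variable: its four real components are
independent `N(0, 1/4)` random variables. -/
structure IsStdGaussian {Ω : Type*} [MeasurableSpace Ω] (X : Ω → ℍ[ℝ]) (P : Measure Ω) :
    Prop where
  hasLaw : ∀ a : Fin 4, HasLaw (fun ω => Quaternion.equivTuple ℝ (X ω) a) (gaussianReal 0 (1 / 4)) P
  indep : iIndepFun (fun (a : Fin 4) ω => Quaternion.equivTuple ℝ (X ω) a) P

/-- `G` is an `M × N` random matrix whose entries are independent standard quaternionic Gaussian
random variables (a quaternion-valued variable being identified with its vector of four real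
components). -/
structure IsGaussianMatrix {Ω : Type*} [MeasurableSpace Ω] {M N : ℕ}
    (G : Ω → Matrix (Fin M) (Fin N) ℍ[ℝ]) (P : Measure Ω) : Prop where
  entry : ∀ κ ι, IsStdGaussian (fun ω => G ω κ ι) P
  indep : iIndepFun (fun (p : Fin M × Fin N) ω => Quaternion.equivTuple ℝ (G ω p.1 p.2)) P

/-- The Wishart matrix `(1/N) G^* D G`. -/
noncomputable def wishart {M N : ℕ} (G : Matrix (Fin M) (Fin N) ℍ[ℝ])
    (D : Matrix (Fin M) (Fin M) ℍ[ℝ]) : Matrix (Fin N) (Fin N) ℍ[ℝ] :=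
  (N : ℝ)⁻¹ • (G.conjTranspose * D * G)

/-- The function `f(α) = Re_{FD(α⁻¹)} tr_{FD(α⁻¹)} (D_1, …, D_n)`. -/
noncomputable def wishartCumulant (N : ℕ) {n M : ℕ} (D : Fin n → Matrix (Fin M) (Fin M) ℍ[ℝ])
    (α : Equiv.Perm (SignedIdx n)) : ℂ :=
  reTr N α⁻¹ D

end QWishart

namespace QWishart

open MeasureTheory ProbabilityTheory

open scoped NNReal

/-! ### Gaussian integration by parts and Wick's recursion -/

/-! The formula is Wick's theorem, reorganised. Expanding the matrix products writes the product of
Wishart entries as a sum over `f : ±[n] → [M] × {1,-1}` of a deterministic factor times `2n`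
Gaussian factors: a conjugated entry of `G` at each positive position, a plain entry at each
negative one. Each factor is a complex linear form in independent real Gaussians, so its conjugate
is just another linear form. Integration by parts gives the recursion
`IsGaussianFamily.wick_recursion`, and `wick_expansion` solves it by a sum over perfect matchings of
`±[n]`.

A matching `p` corresponds to `α ∈ PM(n)` through `p = δα = α⁻¹δ` (`delta_mul_mem_matchings_iff`).
Put `π = α⁻¹`. Every pair of `p = πδ` has exactly one point in `FD(π)`, so covariances are indexed
by `FD(π)`. They vanish unless the indices satisfy the matching conditions; those on `ι, η` select
the admissible `α`, while those on `f` leave free exactly its values on `FD(π)` (`extendFD`). The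
remaining sum over `f` is then the sum over `(i, h)` defining the traces, the matrices at negative
positions turning into adjoints by `qEntry_star'`.

Two bookkeeping matters remain. In `prod_signs` the signs from covariances and adjoints lose all
dependence on `h`, leaving `η_k η_{-k}`. The scalar `N⁻ⁿ 2⁻ⁿ` (each covariance is `±1/2`) is matched
with the trace normalisation through `#(α) = 2 #(FD(α))`, that is `numCycles_eq_two_mul`. -/

lemma integrable_pow_gaussianReal (v : ℝ≥0) (m : ℕ) :
    Integrable (fun x : ℝ => x ^ m) (gaussianReal 0 v) := by
  have h := (memLp_id_gaussianReal (μ := 0) (v := v) (m : ℝ≥0)).integrable_norm_pow'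
  refine h.mono (by fun_prop) (Filter.Eventually.of_forall fun x => ?_)
  simp

lemma hasDerivAt_gaussianPDFReal {v : ℝ≥0} (x : ℝ) :
    HasDerivAt (gaussianPDFReal 0 v) (-(x / v) * gaussianPDFReal 0 v x) x := by
  unfold gaussianPDFReal
  have h : HasDerivAt (fun x : ℝ => -(x - 0) ^ 2 / (2 * (v : ℝ))) (-(x / v)) x := by
    have := (((hasDerivAt_id x).sub_const 0).pow 2).neg.div_const (2 * (v : ℝ))
    convert! this using 1
    simp
    ring
  convert! (h.exp).const_mul ((√(2 * Real.pi * v))⁻¹) using 1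
  ring

/-- Stein's recursion for the moments of a centred Gaussian variable. -/
lemma integral_pow_succ_gaussianReal {v : ℝ≥0} (hv : v ≠ 0) (m : ℕ) :
    ∫ x, x ^ (m + 1) ∂(gaussianReal 0 v) = v * m * ∫ x, x ^ (m - 1) ∂(gaussianReal 0 v) := by
  have hi : ∀ k : ℕ, Integrable (fun x : ℝ => gaussianPDFReal 0 v x * x ^ k) := by
    intro k
    have h := integrable_pow_gaussianReal v k
    rw [gaussianReal_of_var_ne_zero _ hv, integrable_withDensity_iff_integrable_smul'
      (measurable_gaussianPDF _ _) (Filter.Eventually.of_forall fun _ => gaussianPDF_lt_top)] at h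
    simpa using h
  have hv' : (v : ℝ) ≠ 0 := by exact_mod_cast hv
  rw [integral_gaussianReal_eq_integral_smul hv, integral_gaussianReal_eq_integral_smul hv]
  -- The density `φ` satisfies `φ' = -(x/v) φ`, which supplies the extra power of `x`. For `m = 0`
  -- the truncated exponent `m - 1` is harmless because its coefficient vanishes.
  have h := integral_mul_deriv_eq_deriv_mul_of_integrable
    (u := fun x : ℝ => x ^ m) (u' := fun x => m * x ^ (m - 1))
    (v := gaussianPDFReal 0 v) (v' := fun x => -(x / v) * gaussianPDFReal 0 v x)
    (fun x _ => hasDerivAt_pow m x) (fun x _ => hasDerivAt_gaussianPDFReal x)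
    (((hi (m + 1)).const_mul (-(v : ℝ)⁻¹)).congr (Filter.Eventually.of_forall fun x => by
      simp only [Pi.mul_apply]; ring))
    (((hi (m - 1)).const_mul (m : ℝ)).congr (Filter.Eventually.of_forall fun x => by
      simp only [Pi.mul_apply]; ring))
    ((hi m).congr (Filter.Eventually.of_forall fun x => by simp only [Pi.mul_apply]; ring))
  have h1 : ∫ x : ℝ, x ^ m * (-(x / v) * gaussianPDFReal 0 v x)
      = -(v : ℝ)⁻¹ * ∫ x, gaussianPDFReal 0 v x • x ^ (m + 1) := by
    rw [← integral_const_mul]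
    refine integral_congr_ae (Filter.Eventually.of_forall fun x => ?_)
    simp only [smul_eq_mul]
    ring
  have h2 : ∫ x : ℝ, (m * x ^ (m - 1)) * gaussianPDFReal 0 v x
      = m * ∫ x, gaussianPDFReal 0 v x • x ^ (m - 1) := by
    rw [← integral_const_mul]
    refine integral_congr_ae (Filter.Eventually.of_forall fun x => ?_)
    simp only [smul_eq_mul]
    ring
  rw [h1, h2] at h
  field_simp at h
  linarith

/-- A finite family of centred Gaussian variables of variance `v` whose joint moments factorize. -/
structure IsGaussianFamily {Ω T : Type*} [MeasurableSpace Ω] [Fintype T] (ξ : T → Ω → ℝ)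
    (v : ℝ≥0) (P : Measure Ω) : Prop where
  hasLaw : ∀ t, HasLaw (ξ t) (gaussianReal 0 v) P
  moment : ∀ m : T → ℕ, ∫ ω, ∏ t, ξ t ω ^ m t ∂P = ∏ t, ∫ ω, ξ t ω ^ m t ∂P

/-- Evaluation of a polynomial at the variables of the family. -/
noncomputable def polyEval {Ω T : Type*} (ξ : T → Ω → ℝ) (ω : Ω) : MvPolynomial T ℂ →ₐ[ℂ] ℂ :=
  MvPolynomial.aeval fun t => (ξ t ω : ℂ)

lemma polyEval_monomial {Ω T : Type*} [Fintype T] (ξ : T → Ω → ℝ) (ω : Ω) (m : T →₀ ℕ) (a : ℂ) :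
    polyEval ξ ω (MvPolynomial.monomial m a) = a * ((∏ t, ξ t ω ^ m t : ℝ) : ℂ) := by
  simp [polyEval, MvPolynomial.aeval_monomial, Finsupp.prod_fintype]

/-- Joint moments factorize, so only the exponent at `t` moves and the one-variable recursion
applies. This is integration by parts on monomials. -/
lemma IsGaussianFamily.moment_add_one {Ω T : Type*} [MeasurableSpace Ω] [Fintype T]
    {ξ : T → Ω → ℝ} {v : ℝ≥0} {P : Measure Ω} (h : IsGaussianFamily ξ v P) (hv : v ≠ 0) [DecidableEq T]
    (m : T → ℕ) (t : T) :
    ∫ ω, ξ t ω * ∏ s, ξ s ω ^ m s ∂P =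
      v * m t * ∫ ω, ∏ s, ξ s ω ^ (m s - if s = t then 1 else 0) ∂P := by
  have h0 : ∀ s k, ∫ ω, ξ s ω ^ k ∂P = ∫ x, x ^ k ∂(gaussianReal 0 v) := fun s k => by
    have := (h.hasLaw s).integral_comp (f := fun x : ℝ => x ^ k) (by fun_prop)
    simpa using this
  have h1 : ∀ ω, ξ t ω * ∏ s, ξ s ω ^ m s = ∏ s, ξ s ω ^ (m s + if s = t then 1 else 0) := by
    intro ω
    simp only [pow_add, Finset.prod_mul_distrib]
    rw [mul_comm]
    congr 1
    simp [Finset.prod_ite_eq', pow_ite]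
  simp only [h1]
  rw [h.moment, h.moment]
  simp only [h0]
  rw [← Finset.mul_prod_erase _ _ (Finset.mem_univ t), ← Finset.mul_prod_erase _ _ (Finset.mem_univ t)]
  simp only [if_true]
  rw [integral_pow_succ_gaussianReal hv, mul_assoc]
  congr 2
  refine Finset.prod_congr rfl fun s hs => ?_
  simp [Finset.ne_of_mem_erase hs]

section Family

variable {Ω T : Type*} [MeasurableSpace Ω] [Fintype T] {ξ : T → Ω → ℝ} {v : ℝ≥0}
  {P : Measure Ω} [IsProbabilityMeasure P]

lemma memLp_pow_gaussian {X : Ω → ℝ} (h : HasLaw X (gaussianReal 0 v) P) (m p : ℕ) :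
    MemLp (fun ω => X ω ^ m) p P := by
  have h1 : MemLp (fun ω => X ω) ((m * p : ℕ) : ℝ≥0) P := by
    have := memLp_id_gaussianReal (μ := 0) (v := v) ((m * p : ℕ) : ℝ≥0)
    rw [← h.map_eq] at this
    exact (memLp_map_measure_iff (by fun_prop) h.aemeasurable).1 this
  rcases Nat.eq_zero_or_pos m with rfl | hm
  · simpa using memLp_const (1 : ℝ)
  rcases Nat.eq_zero_or_pos p with rfl | hp
  · simpa using (h.aemeasurable.pow_const m).aestronglyMeasurable
  have h2 := h1.norm_rpow_div (q := (m : ENNReal))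
  refine MemLp.of_le (g := fun ω => ‖X ω‖ ^ (m : ENNReal).toReal) ?_
    (h.aemeasurable.aestronglyMeasurable.pow m) (Filter.Eventually.of_forall fun x => by simp)
  convert! h2 using 1
  rw [ENNReal.eq_div_iff (by simp; omega) (by simp)]
  simp

lemma IsGaussianFamily.integrable_prod_pow (h : IsGaussianFamily ξ v P) (m : T → ℕ) :
    Integrable (fun ω => ∏ t, ξ t ω ^ m t) P := by
  -- Hölder with every exponent equal to `|T| + 1`: the reciprocals then sum to at most `1`.
  have h1 := MemLp.prod' (s := Finset.univ) (μ := P) (f := fun t ω => ξ t ω ^ m t)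
    (p := fun _ => (((Fintype.card T + 1 : ℕ)) : ENNReal))
    (fun t _ => memLp_pow_gaussian (h.hasLaw t) _ _)
  refine h1.integrable ?_
  rw [ENNReal.one_le_inv]
  simp only [Finset.sum_const, Finset.card_univ, nsmul_eq_mul]
  rw [← div_eq_mul_inv]
  refine ENNReal.div_le_of_le_mul ?_
  simp

lemma IsGaussianFamily.integrable_polyEval (h : IsGaussianFamily ξ v P) (p : MvPolynomial T ℂ) :
    Integrable (fun ω => polyEval ξ ω p) P := by
  induction p using MvPolynomial.induction_on' with
  | monomial m a =>
    simp only [polyEval_monomial]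
    exact ((h.integrable_prod_pow _).ofReal).const_mul a
  | add p q hp hq =>
    simp only [map_add]
    exact hp.add hq

/-- Gaussian integration by parts. -/
lemma IsGaussianFamily.integral_X_mul (h : IsGaussianFamily ξ v P) (hv : v ≠ 0) (t : T)
    (p : MvPolynomial T ℂ) :
    ∫ ω, (ξ t ω : ℂ) * polyEval ξ ω p ∂P = v * ∫ ω, polyEval ξ ω (MvPolynomial.pderiv t p) ∂P := by
  classical
  have hi : ∀ p, Integrable (fun ω => (ξ t ω : ℂ) * polyEval ξ ω p) P := fun p => by
    have := h.integrable_polyEval (MvPolynomial.X t * p)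
    simpa [polyEval] using this
  induction p using MvPolynomial.induction_on' with
  | monomial m a =>
    simp only [MvPolynomial.pderiv_monomial, polyEval_monomial]
    have h1 := h.moment_add_one hv m t
    have h2 : ∀ ω, (ξ t ω : ℂ) * (a * ((∏ t, ξ t ω ^ m t : ℝ) : ℂ))
        = a * ((ξ t ω * ∏ t, ξ t ω ^ m t : ℝ) : ℂ) := fun ω => by push_cast; ring
    simp only [h2]
    rw [integral_const_mul, integral_const_mul, integral_complex_ofReal, integral_complex_ofReal, h1]
    have h3 : ∀ s, (m - Finsupp.single t 1 : T →₀ ℕ) s = m s - if s = t then 1 else 0 := fun s => by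
      simp [Finsupp.single_apply, eq_comm]
    simp only [h3]
    push_cast
    ring
  | add p q hp hq =>
    simp only [map_add, mul_add]
    rw [integral_add (hi p) (hi q), hp, hq, integral_add (h.integrable_polyEval _)
      (h.integrable_polyEval _)]
    ring

end Family

/-- The linear form with coefficients `c`. -/
noncomputable def linForm {T : Type*} [Fintype T] (c : T → ℂ) : MvPolynomial T ℂ :=
  ∑ t, MvPolynomial.C (c t) * MvPolynomial.X t

lemma pderiv_linForm {T : Type*} [Fintype T] (c : T → ℂ) (t : T) :
    MvPolynomial.pderiv t (linForm c) = MvPolynomial.C (c t) := by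
  classical
  simp [linForm, MvPolynomial.pderiv_X, Pi.single_apply]

lemma pderiv_prod_linForm {T ι : Type*} [Fintype T] [DecidableEq ι] (c : ι → T → ℂ) (t : T)
    (S : Finset ι) :
    MvPolynomial.pderiv t (∏ x ∈ S, linForm (c x)) =
      ∑ y ∈ S, MvPolynomial.C (c y t) * ∏ x ∈ S.erase y, linForm (c x) := by
  induction S using Finset.induction_on with
  | empty => simp
  | insert a S ha ih =>
    rw [Finset.prod_insert ha, MvPolynomial.pderiv_mul, pderiv_linForm, ih, Finset.sum_insert ha,
      Finset.erase_insert ha, Finset.mul_sum]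
    congr 1
    refine Finset.sum_congr rfl fun y hy => ?_
    have : a ≠ y := fun h => ha (h ▸ hy)
    rw [Finset.erase_insert_of_ne this, Finset.prod_insert (by simp [ha])]
    ring

/-- Integrating by parts in each coordinate of the form at `x` differentiates the other factors one
at a time; summing over coordinates pairs `x` with `y` with weight their covariance, bilinear and
without conjugation. -/
lemma IsGaussianFamily.wick_recursion {Ω T ι : Type*} [MeasurableSpace Ω] [Fintype T]
    [DecidableEq ι] {ξ : T → Ω → ℝ} {v : ℝ≥0} {P : Measure Ω} [IsProbabilityMeasure P]
    (h : IsGaussianFamily ξ v P) (hv : v ≠ 0) (c : ι → T → ℂ) (x : ι) (S : Finset ι) (hx : x ∉ S) :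
    ∫ ω, polyEval ξ ω (∏ y ∈ insert x S, linForm (c y)) ∂P =
      ∑ y ∈ S, (v * ∑ t, c x t * c y t) *
        ∫ ω, polyEval ξ ω (∏ z ∈ S.erase y, linForm (c z)) ∂P := by
  have h1 : ∀ ω, polyEval ξ ω (∏ y ∈ insert x S, linForm (c y)) =
      ∑ t, c x t * ((ξ t ω : ℂ) * polyEval ξ ω (∏ y ∈ S, linForm (c y))) := fun ω => by
    rw [Finset.prod_insert hx, map_mul, linForm, map_sum, Finset.sum_mul]
    refine Finset.sum_congr rfl fun t _ => ?_
    simp [polyEval, mul_assoc]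
  simp only [h1]
  rw [integral_finsetSum _ fun t _ => by
    have := h.integrable_polyEval (MvPolynomial.X t * (∏ y ∈ S, linForm (c y)))
    simp only [map_mul] at this
    simpa [polyEval] using this.const_mul (c x t)]
  have h2 : ∀ t, ∫ ω, polyEval ξ ω (∑ y ∈ S, MvPolynomial.C (c y t) *
      ∏ x ∈ S.erase y, linForm (c x)) ∂P = ∑ y ∈ S, c y t *
      ∫ ω, polyEval ξ ω (∏ x ∈ S.erase y, linForm (c x)) ∂P := by
    intro t
    have h3 : ∀ ω y, polyEval ξ ω (MvPolynomial.C (c y t) * ∏ x ∈ S.erase y, linForm (c x)) =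
        c y t * polyEval ξ ω (∏ x ∈ S.erase y, linForm (c x)) := fun ω y => by
      rw [map_mul]
      simp [polyEval]
    simp only [map_sum, h3]
    rw [integral_finsetSum _ fun y _ => (h.integrable_polyEval _).const_mul _]
    simp only [integral_const_mul]
  simp only [integral_const_mul, h.integral_X_mul hv, pderiv_prod_linForm, h2, Finset.mul_sum,
    Finset.sum_mul]
  rw [Finset.sum_comm]
  refine Finset.sum_congr rfl fun y _ => Finset.sum_congr rfl fun t _ => ?_
  ring

/-! ### Perfect matchings and the solution of the Wick recursion -/

section Matchings

variable {ι : Type*} [DecidableEq ι]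

lemma swap_mul_apply_of_fixed {p : Equiv.Perm ι} {x y : ι} (hx : p x = x) (hy : p y = y) (z : ι) :
    (Equiv.swap x y * p) z = if z = x then y else if z = y then x else p z := by
  rw [Equiv.Perm.mul_apply]
  split_ifs with h1 h2
  · subst h1; rw [hx, Equiv.swap_apply_left]
  · subst h2; rw [hy, Equiv.swap_apply_right]
  · refine Equiv.swap_apply_of_ne_of_ne (fun h => h1 ?_) (fun h => h2 ?_)
    · exact p.injective (h.trans hx.symm)
    · exact p.injective (h.trans hy.symm)

lemma swap_mul_apply_of_swapped {p : Equiv.Perm ι} {x y : ι} (hx : p x = y) (hy : p y = x) (z : ι) :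
    (Equiv.swap x y * p) z = if z = x then x else if z = y then y else p z := by
  rw [Equiv.Perm.mul_apply]
  split_ifs with h1 h2
  · subst h1; rw [hx, Equiv.swap_apply_right]
  · subst h2; rw [hy, Equiv.swap_apply_left]
  · refine Equiv.swap_apply_of_ne_of_ne (fun h => h2 ?_) (fun h => h1 ?_)
    · exact p.injective (h.trans hy.symm)
    · exact p.injective (h.trans hx.symm)

/-- A product over the pairs of a matching does not depend on the chosen representatives. -/
lemma prod_transversal_eq {p : Equiv.Perm ι} (hp : ∀ x, p (p x) = x) {f : ι → ℂ}
    (hf : ∀ x, f (p x) = f x) {R R' : Finset ι} (hR : ∀ x, p x ∈ R ↔ x ∉ R)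
    (hR' : ∀ x, p x ∈ R' ↔ x ∉ R') : ∏ x ∈ R, f x = ∏ x ∈ R', f x := by
  refine Finset.prod_bij' (fun x _ => if x ∈ R' then x else p x)
    (fun x _ => if x ∈ R then x else p x) ?_ ?_ ?_ ?_ ?_ <;> intro x hx
  · have := hR' x
    grind
  · have := hR x
    grind
  · have := hR x; have := hp x
    grind
  · have := hR' x; have := hp x
    grind
  · split_ifs
    · rfl
    · exact (hf x).symm

variable [Fintype ι]

/-- The fixed-point-free involutions of `S`, extended by the identity. -/
def matchings (S : Finset ι) : Finset (Equiv.Perm ι) :=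
  Finset.univ.filter fun p => (∀ x, p (p x) = x) ∧ ∀ x, p x ≠ x ↔ x ∈ S

lemma mem_matchings {S : Finset ι} {p : Equiv.Perm ι} :
    p ∈ matchings S ↔ (∀ x, p (p x) = x) ∧ ∀ x, p x ≠ x ↔ x ∈ S := by
  simp [matchings]

lemma matchings_empty : matchings (∅ : Finset ι) = {1} := by
  ext p
  rw [mem_matchings, Finset.mem_singleton]
  constructor
  · rintro ⟨-, h⟩
    ext x
    simpa using h x
  · rintro rfl
    simp

lemma swap_mul_mem_matchings_erase {S : Finset ι} {x y : ι} {p : Equiv.Perm ι} (hx : x ∉ S)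
    (hp : p ∈ matchings (insert x S)) (hxy : p x = y) :
    Equiv.swap x y * p ∈ matchings (S.erase y) := by
  rw [mem_matchings] at hp ⊢
  have hy : p y = x := by rw [← hxy, hp.1]
  refine ⟨fun z => ?_, fun z => ?_⟩
  · rw [swap_mul_apply_of_swapped hxy hy, swap_mul_apply_of_swapped hxy hy]
    have h1 := hp.1 z
    grind
  · rw [swap_mul_apply_of_swapped hxy hy]
    have h1 := hp.2 z
    grind

lemma swap_mul_mem_matchings_insert {S : Finset ι} {x y : ι} {p : Equiv.Perm ι} (hx : x ∉ S)
    (hy : y ∈ S) (hp : p ∈ matchings (S.erase y)) :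
    Equiv.swap x y * p ∈ matchings (insert x S) := by
  rw [mem_matchings] at hp ⊢
  have hpx : p x = x := by
    have := hp.2 x
    grind
  have hpy : p y = y := by
    have := hp.2 y
    grind
  have hxy : x ≠ y := fun h => hx (h ▸ hy)
  refine ⟨fun z => ?_, fun z => ?_⟩
  · rw [swap_mul_apply_of_fixed hpx hpy, swap_mul_apply_of_fixed hpx hpy]
    have h1 := hp.1 z
    grind
  · rw [swap_mul_apply_of_fixed hpx hpy]
    have h1 := hp.2 z
    grind

/-- The combinatorial part of Wick's formula: a functional on finite sets satisfying the Wick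
recursion is a sum over perfect matchings. -/
theorem wick_expansion {r : ι → ℕ} (hr : Function.Injective r) (c : ι → ι → ℂ)
    (F : Finset ι → ℂ) (h0 : F ∅ = 1)
    (hF : ∀ x S, x ∉ S → F (insert x S) = ∑ y ∈ S, c x y * F (S.erase y)) (S : Finset ι) :
    F S = ∑ p ∈ matchings S, ∏ x ∈ S, if r x < r (p x) then c x (p x) else 1 := by
  induction S using Finset.strongInduction with
  | H S ih =>
    rcases S.eq_empty_or_nonempty with rfl | hS
    · simp [matchings_empty, h0]
    -- The ranking `r` only orients pairs. Expanding at the point of least rank makes the recursion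
    -- produce its pair in the orientation counted by the product.
    obtain ⟨x, hxS, hmin⟩ := S.exists_min_image r hS
    obtain ⟨S', hx, rfl⟩ : ∃ S', x ∉ S' ∧ insert x S' = S :=
      ⟨S.erase x, by simp, Finset.insert_erase hxS⟩
    have hlt : ∀ y ∈ S', r x < r y := fun y hy =>
      lt_of_le_of_ne (hmin y (by simp [hy])) fun h => hx (hr h ▸ hy)
    rw [hF x S' hx, ← Finset.sum_fiberwise_of_maps_to (t := S') (g := fun p : Equiv.Perm ι => p x)]
    swap
    · intro p hp
      rw [mem_matchings] at hp
      have h1 := (hp.2 x).2 (by simp)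
      have h2 := (hp.2 (p x)).1 (fun h => h1 (p.injective h))
      exact (Finset.mem_insert.1 h2).resolve_left h1
    refine Finset.sum_congr rfl fun y hy => ?_
    have hxy : x ≠ y := fun h => hx (h ▸ hy)
    rw [ih (S'.erase y) ((Finset.erase_subset _ _).trans_ssubset (Finset.ssubset_insert hx)),
      Finset.mul_sum]
    -- Left multiplication by the transposition both inserts and deletes the pair `{x, y}`, hence is
    -- its own inverse.
    refine Finset.sum_bij' (fun p _ => Equiv.swap x y * p) (fun p _ => Equiv.swap x y * p)
      ?_ ?_ ?_ ?_ ?_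
    · intro p hp
      refine Finset.mem_filter.2 ⟨swap_mul_mem_matchings_insert hx hy hp, ?_⟩
      rw [mem_matchings] at hp
      have hpx : p x = x := by
        have := hp.2 x
        grind
      rw [Equiv.Perm.mul_apply, hpx, Equiv.swap_apply_left]
    · intro p hp
      rw [Finset.mem_filter] at hp
      exact swap_mul_mem_matchings_erase hx hp.1 hp.2
    · intro p _
      rw [← mul_assoc, Equiv.swap_mul_self, one_mul]
    · intro p _
      rw [← mul_assoc, Equiv.swap_mul_self, one_mul]
    · intro p hp
      rw [mem_matchings] at hp
      have hpx : p x = x := by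
        have := hp.2 x
        grind
      have hpy : p y = y := by
        have := hp.2 y
        grind
      rw [Finset.prod_insert hx, ← Finset.mul_prod_erase _ _ hy]
      simp only [swap_mul_apply_of_fixed hpx hpy, if_true, hlt y hy, hxy.symm, if_false,
        (hlt y hy).not_gt, one_mul]
      congr 1
      refine Finset.prod_congr rfl fun z hz => ?_
      have h1 : z ≠ y := Finset.ne_of_mem_erase hz
      have h2 : z ≠ x := fun h => hx (h ▸ Finset.mem_of_mem_erase hz)
      simp only [h1, h2, if_false]

end Matchings

/-! ### Entries of quaternions -/

lemma intUnits_cases (s : ℤˣ) : s = 1 ∨ s = -1 := Int.units_eq_one_or s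

lemma neg_one_ne_one_units : (-1 : ℤˣ) ≠ 1 := by decide

lemma sum_intUnits {A : Type*} [AddCommMonoid A] (f : ℤˣ → A) : ∑ s, f s = f 1 + f (-1) := by
  rw [UnitsInt.univ, Finset.sum_pair (by decide)]

lemma qEntry_zero (η θ : ℤˣ) : qEntry 0 η θ = 0 := by
  rcases intUnits_cases η with rfl | rfl <;> rcases intUnits_cases θ with rfl | rfl <;>
    simp [qEntry, Complex.ext_iff]

lemma qEntry_add (p q : ℍ[ℝ]) (η θ : ℤˣ) : qEntry (p + q) η θ = qEntry p η θ + qEntry q η θ := by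
  rcases intUnits_cases η with rfl | rfl <;> rcases intUnits_cases θ with rfl | rfl <;>
    simp [qEntry, Complex.ext_iff, add_comm]

lemma qEntry_sum {κ : Type*} (s : Finset κ) (f : κ → ℍ[ℝ]) (η θ : ℤˣ) :
    qEntry (∑ i ∈ s, f i) η θ = ∑ i ∈ s, qEntry (f i) η θ :=
  map_sum (⟨⟨fun q => qEntry q η θ, qEntry_zero η θ⟩, fun p q => qEntry_add p q η θ⟩ : ℍ[ℝ] →+ ℂ)
    f s

lemma qEntry_smul (r : ℝ) (q : ℍ[ℝ]) (η θ : ℤˣ) : qEntry (r • q) η θ = r * qEntry q η θ := by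
  rcases intUnits_cases η with rfl | rfl <;> rcases intUnits_cases θ with rfl | rfl <;>
    simp [qEntry, Complex.ext_iff]

lemma qEntry_mul (p q : ℍ[ℝ]) (η θ : ℤˣ) :
    qEntry (p * q) η θ = ∑ h, qEntry p η h * qEntry q h θ := by
  rw [sum_intUnits]
  rcases intUnits_cases η with rfl | rfl <;> rcases intUnits_cases θ with rfl | rfl <;>
    simp [qEntry, Complex.ext_iff] <;> constructor <;> ring

lemma qEntry_star (q : ℍ[ℝ]) (η θ : ℤˣ) :
    qEntry (star q) η θ = starRingEnd ℂ (qEntry q θ η) := by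
  rcases intUnits_cases η with rfl | rfl <;> rcases intUnits_cases θ with rfl | rfl <;>
    simp [qEntry, Complex.ext_iff]

/-- Opposite entries of the matrix of a quaternion are conjugate up to sign. This gives the adjoint
without complex conjugation, as needed for the deterministic matrices. -/
lemma qEntry_star' (q : ℍ[ℝ]) (η θ : ℤˣ) :
    qEntry (star q) η θ = ((η * θ : ℤˣ) : ℤ) * qEntry q (-θ) (-η) := by
  rcases intUnits_cases η with rfl | rfl <;> rcases intUnits_cases θ with rfl | rfl <;>
    simp [qEntry, Complex.ext_iff]

/-- The coefficients of the entries `[q]_{h θ}` as linear forms in the real components of `q`. -/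
noncomputable def qCoeff (h θ : ℤˣ) : Fin 4 → ℂ :=
  if h = 1 then
    if θ = 1 then ![1, Complex.I, 0, 0] else ![0, 0, 1, Complex.I]
  else
    if θ = 1 then ![0, 0, -1, Complex.I] else ![1, -Complex.I, 0, 0]

lemma qEntry_eq_sum (q : ℍ[ℝ]) (h θ : ℤˣ) :
    qEntry q h θ = ∑ a, qCoeff h θ a * (Quaternion.equivTuple ℝ q a : ℂ) := by
  rcases intUnits_cases h with rfl | rfl <;> rcases intUnits_cases θ with rfl | rfl <;>
    simp [qEntry, qCoeff, Complex.ext_iff, Fin.sum_univ_four]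

/-- The coefficients of `[q]_{h θ}` (for `s = -1`) or of its conjugate (for `s = 1`). -/
noncomputable def signedCoeff (s h θ : ℤˣ) (a : Fin 4) : ℂ :=
  if s = 1 then starRingEnd ℂ (qCoeff h θ a) else qCoeff h θ a

/-- A plain and a conjugated factor correlate when they come from the same entry. Two factors of the
same kind correlate when the entries are opposite, since `q_{-h,-θ} = hθ · conj q_{h,θ}`; this is
the origin of the sign. -/
lemma sum_signedCoeff (s h θ s' h' θ' : ℤˣ) :
    ∑ a, signedCoeff s h θ a * signedCoeff s' h' θ' a =
      if s * h = -(s' * h') ∧ s * θ = -(s' * θ') then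
        2 * (if s = s' then (((h * θ : ℤˣ) : ℤ) : ℂ) else 1) else 0 := by
  have e1 : (1 : ℤˣ) ≠ -1 := by decide
  rcases intUnits_cases s with rfl | rfl <;> rcases intUnits_cases h with rfl | rfl <;>
  rcases intUnits_cases θ with rfl | rfl <;> rcases intUnits_cases s' with rfl | rfl <;>
  rcases intUnits_cases h' with rfl | rfl <;> rcases intUnits_cases θ' with rfl | rfl <;>
    simp [signedCoeff, qCoeff, Fin.sum_univ_four, e1] <;> norm_num

lemma sum_intUnits_fun {A : Type*} [Fintype A] [DecidableEq A] (F : A → A → ℂ) :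
    ∑ f : ℤˣ → A, F (f 1) (f (-1)) = ∑ a, ∑ b, F a b := by
  rw [← Fintype.sum_prod_type']
  refine Fintype.sum_equiv ⟨fun f => (f 1, f (-1)), fun p s => if s = 1 then p.1 else p.2,
    fun f => ?_, fun p => ?_⟩ _ _ fun f => rfl
  · ext s
    rcases intUnits_cases s with rfl | rfl <;> simp
  · simp

/-- The two summation indices next to `D` are packed as a function of a sign, so that a product over
`k ∈ [n]` becomes a sum over functions on `±[n]` by uncurrying. -/
lemma qEntry_wishart {M N : ℕ} (G : Matrix (Fin M) (Fin N) ℍ[ℝ])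
    (D : Matrix (Fin M) (Fin M) ℍ[ℝ]) (i j : Fin N) (θ θ' : ℤˣ) :
    qEntry (wishart G D i j) θ θ' = (N : ℂ)⁻¹ * ∑ f : ℤˣ → Fin M × ℤˣ,
      (starRingEnd ℂ (qEntry (G (f 1).1 i) (f 1).2 θ) * qEntry (G (f (-1)).1 j) (f (-1)).2 θ') *
        qEntry (D (f 1).1 (f (-1)).1) (f 1).2 (f (-1)).2 := by
  rw [sum_intUnits_fun fun a b : Fin M × ℤˣ => (starRingEnd ℂ (qEntry (G a.1 i) a.2 θ) *
    qEntry (G b.1 j) b.2 θ') * qEntry (D a.1 b.1) a.2 b.2]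
  simp only [wishart, Matrix.smul_apply, qEntry_smul, Matrix.mul_apply, qEntry_sum, qEntry_mul,
    Matrix.conjTranspose_apply, qEntry_star, Fintype.sum_prod_type, Finset.sum_mul]
  push_cast
  congr 1
  calc _ = ∑ b : Fin M × ℤˣ, ∑ a : Fin M × ℤˣ,
        (starRingEnd ℂ (qEntry (G a.1 i) a.2 θ) * qEntry (G b.1 j) b.2 θ') *
          qEntry (D a.1 b.1) a.2 b.2 := by
        simp only [Fintype.sum_prod_type]
        refine Finset.sum_congr rfl fun b _ => ?_
        rw [Finset.sum_comm]
        refine Finset.sum_congr rfl fun h _ => Finset.sum_congr rfl fun a _ =>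
          Finset.sum_congr rfl fun h' _ => ?_
        ring
    _ = _ := by
        rw [Finset.sum_comm]
        simp only [Fintype.sum_prod_type]

/-! ### Moments of the Wishart entries -/

/-- The real components of the entries of a quaternionic matrix. -/
noncomputable def component {Ω : Type*} {M N : ℕ} (G : Ω → Matrix (Fin M) (Fin N) ℍ[ℝ])
    (t : (Fin M × Fin N) × Fin 4) (ω : Ω) : ℝ :=
  Quaternion.equivTuple ℝ (G ω t.1.1 t.1.2) t.2

/-- Independence is used twice: between entries, then between the four components of one entry. -/
lemma IsGaussianMatrix.isGaussianFamily {Ω : Type*} [MeasurableSpace Ω] {M N : ℕ}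
    {G : Ω → Matrix (Fin M) (Fin N) ℍ[ℝ]} {P : Measure Ω} (hG : IsGaussianMatrix G P) :
    IsGaussianFamily (component G) (1 / 4) P where
  hasLaw t := (hG.entry t.1.1 t.1.2).hasLaw t.2
  moment m := by
    have hmeas : ∀ κ ι a, AEMeasurable (fun ω => Quaternion.equivTuple ℝ (G ω κ ι) a) P :=
      fun κ ι a => ((hG.entry κ ι).hasLaw a).aemeasurable
    have h0 : ∀ ω, ∏ t, component G t ω ^ m t =
        ∏ p : Fin M × Fin N, ∏ a, Quaternion.equivTuple ℝ (G ω p.1 p.2) a ^ m (p, a) :=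
      fun ω => Fintype.prod_prod_type _
    simp only [h0]
    rw [Fintype.prod_prod_type, hG.indep.integral_fun_prod_comp
      (f := fun p (x : Fin 4 → ℝ) => ∏ a, x a ^ m (p, a))
      (fun p => aemeasurable_pi_lambda _ fun a => hmeas p.1 p.2 a)
      (fun p => (continuous_finsetProd _ fun a _ =>
        (continuous_apply a).pow _).aestronglyMeasurable)]
    refine Finset.prod_congr rfl fun p _ => ?_
    exact (hG.entry p.1 p.2).indep.integral_fun_prod_comp (f := fun a (x : ℝ) => x ^ m (p, a))
      (fun a => hmeas p.1 p.2 a) (fun a => (continuous_pow _).aestronglyMeasurable)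

/-- The coefficients of the Gaussian factor at position `x` as a linear form in the components. -/
noncomputable def factorCoeff {M N : ℕ} (s : ℤˣ) (a : Fin M × ℤˣ) (i : Fin N) (θ : ℤˣ)
    (t : (Fin M × Fin N) × Fin 4) : ℂ :=
  if t.1 = (a.1, i) then signedCoeff s a.2 θ t.2 else 0

lemma polyEval_linForm_factorCoeff {Ω : Type*} {M N : ℕ} (G : Ω → Matrix (Fin M) (Fin N) ℍ[ℝ])
    (ω : Ω) (s : ℤˣ) (a : Fin M × ℤˣ) (i : Fin N) (θ : ℤˣ) :
    polyEval (component G) ω (linForm (factorCoeff s a i θ)) =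
      if s = 1 then starRingEnd ℂ (qEntry (G ω a.1 i) a.2 θ) else qEntry (G ω a.1 i) a.2 θ := by
  have h1 : polyEval (component G) ω (linForm (factorCoeff s a i θ)) =
      ∑ b, signedCoeff s a.2 θ b * (Quaternion.equivTuple ℝ (G ω a.1 i) b : ℂ) := by
    simp only [linForm, polyEval, map_sum, map_mul, MvPolynomial.aeval_C, MvPolynomial.aeval_X]
    rw [Fintype.sum_prod_type, Finset.sum_eq_single (a.1, i)]
    · simp [factorCoeff, component]
    · intro b _ hb
      simp [factorCoeff, hb]
    · simp
  rw [h1, qEntry_eq_sum]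
  split_ifs with hs
  · simp [signedCoeff, hs, map_sum]
  · simp [signedCoeff, hs]

lemma sum_factorCoeff {M N : ℕ} (s s' : ℤˣ) (a a' : Fin M × ℤˣ) (i i' : Fin N) (θ θ' : ℤˣ) :
    ∑ t, factorCoeff s a i θ t * factorCoeff s' a' i' θ' t =
      if (a.1 = a'.1 ∧ i = i') ∧ s * a.2 = -(s' * a'.2) ∧ s * θ = -(s' * θ') then
        2 * (if s = s' then (((a.2 * θ : ℤˣ) : ℤ) : ℂ) else 1) else 0 := by
  rw [Fintype.sum_prod_type, Finset.sum_eq_single (a.1, i)]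
  · by_cases h : (a.1 = a'.1 ∧ i = i')
    · simp only [factorCoeff, h, if_true, true_and, and_self]
      exact sum_signedCoeff _ _ _ _ _ _
    · have h' : ¬ ((a.1, i) = (a'.1, i')) := by simpa using h
      simp [factorCoeff, h', h]
  · intro b _ hb
    simp [factorCoeff, hb]
  · simp

/-- The covariance of the Gaussian factors at the positions `x` and `y`. -/
noncomputable def pairWeight {n M N : ℕ} (ι : SignedIdx n → Fin N) (η : SignedIdx n → ℤˣ)
    (f : SignedIdx n → Fin M × ℤˣ) (x y : SignedIdx n) : ℂ :=
  if ((f x).1 = (f y).1 ∧ ι x = ι y) ∧ sgn x * (f x).2 = -(sgn y * (f y).2) ∧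
      sgn x * η x = -(sgn y * η y) then
    (2 : ℂ)⁻¹ * (if sgn x = sgn y then ((((f x).2 * η x : ℤˣ) : ℤ) : ℂ) else 1) else 0

/-- When the signs of `x` and `y` agree, passing from `x` to `y` negates both factors of the sign.
Symmetry allows pairs to be represented by their points in `FD(π)` later. -/
lemma pairWeight_comm {n M N : ℕ} (ι : SignedIdx n → Fin N) (η : SignedIdx n → ℤˣ)
    (f : SignedIdx n → Fin M × ℤˣ) (x y : SignedIdx n) :
    pairWeight ι η f x y = pairWeight ι η f y x := by
  unfold pairWeight
  refine if_ctx_congr ?_ (fun h => ?_) fun _ => rfl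
  · constructor <;> rintro ⟨⟨h1, h2⟩, h3, h4⟩ <;> refine ⟨⟨h1.symm, h2.symm⟩, ?_, ?_⟩
    all_goals first | rw [h3, neg_neg] | rw [h4, neg_neg]
  · obtain ⟨-, h3, h4⟩ := h
    by_cases hs : sgn x = sgn y
    · rw [if_pos hs, if_pos hs.symm]
      rw [hs, ← mul_neg, mul_right_inj] at h3 h4
      rw [h3, h4, neg_mul_neg]
    · rw [if_neg hs, if_neg (Ne.symm hs)]

/-- Wick's formula for the Gaussian factors of a product of Wishart entries. -/
lemma IsGaussianMatrix.integral_factors {Ω : Type*} [MeasurableSpace Ω] {n M N : ℕ}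
    {G : Ω → Matrix (Fin M) (Fin N) ℍ[ℝ]} {P : Measure Ω} [IsProbabilityMeasure P]
    (hG : IsGaussianMatrix G P) {r : SignedIdx n → ℕ} (hr : Function.Injective r)
    (ι : SignedIdx n → Fin N) (η : SignedIdx n → ℤˣ) (f : SignedIdx n → Fin M × ℤˣ) :
    ∫ ω, polyEval (component G) ω (∏ x, linForm (factorCoeff (sgn x) (f x) (ι x) (η x))) ∂P =
      ∑ p ∈ matchings Finset.univ,
        ∏ x, if r x < r (p x) then pairWeight ι η f x (p x) else 1 := by
  refine wick_expansion hr (pairWeight ι η f) (fun S => ∫ ω, polyEval (component G) ω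
    (∏ x ∈ S, linForm (factorCoeff (sgn x) (f x) (ι x) (η x))) ∂P) (by simp) ?_ _
  intro x S hx
  rw [hG.isGaussianFamily.wick_recursion (by simp)
    (fun x => factorCoeff (sgn x) (f x) (ι x) (η x)) x S hx]
  refine Finset.sum_congr rfl fun y _ => ?_
  congr 1
  rw [sum_factorCoeff, pairWeight, mul_ite, mul_zero]
  refine if_congr Iff.rfl ?_ rfl
  push_cast
  ring

/-- The deterministic factor of a product of Wishart entries. -/
noncomputable def detFactor {n M : ℕ} (D : Fin n → Matrix (Fin M) (Fin M) ℍ[ℝ])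
    (f : SignedIdx n → Fin M × ℤˣ) : ℂ :=
  ∏ k, qEntry (D k (f (k, 1)).1 (f (k, -1)).1) (f (k, 1)).2 (f (k, -1)).2

lemma polyEval_prod_linForm_factorCoeff {Ω : Type*} {n M N : ℕ}
    (G : Ω → Matrix (Fin M) (Fin N) ℍ[ℝ]) (ι : SignedIdx n → Fin N) (η : SignedIdx n → ℤˣ) (ω : Ω)
    (f : SignedIdx n → Fin M × ℤˣ) :
    polyEval (component G) ω (∏ x, linForm (factorCoeff (sgn x) (f x) (ι x) (η x))) =
      (∏ k, starRingEnd ℂ (qEntry (G ω (f (k, 1)).1 (ι (k, 1))) (f (k, 1)).2 (η (k, 1)))) *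
        ∏ k, qEntry (G ω (f (k, -1)).1 (ι (k, -1))) (f (k, -1)).2 (η (k, -1)) := by
  rw [map_prod]
  simp only [polyEval_linForm_factorCoeff]
  rw [Fintype.prod_prod_type, ← Finset.prod_mul_distrib]
  refine Finset.prod_congr rfl fun k _ => ?_
  rw [UnitsInt.univ, Finset.prod_pair (by decide)]
  simp [sgn]

lemma prod_qEntry_wishart {Ω : Type*} {n M N : ℕ} (G : Ω → Matrix (Fin M) (Fin N) ℍ[ℝ])
    (D : Fin n → Matrix (Fin M) (Fin M) ℍ[ℝ]) (ι : SignedIdx n → Fin N) (η : SignedIdx n → ℤˣ)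
    (ω : Ω) :
    ∏ k : Fin n, qEntry (wishart (G ω) (D k) (ι (k, 1)) (ι (k, -1))) (η (k, 1)) (η (k, -1)) =
      ∑ f : SignedIdx n → Fin M × ℤˣ, ((N : ℂ)⁻¹ ^ n * detFactor D f) *
        polyEval (component G) ω (∏ x, linForm (factorCoeff (sgn x) (f x) (ι x) (η x))) := by
  simp only [qEntry_wishart, Finset.prod_mul_distrib, Finset.prod_const, Finset.card_univ,
    Fintype.card_fin, Finset.prod_univ_sum, Fintype.piFinset_univ, mul_assoc,
    polyEval_prod_linForm_factorCoeff]
  rw [← Finset.mul_sum]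
  congr 1
  refine (Fintype.sum_equiv (Equiv.curry (Fin n) ℤˣ (Fin M × ℤˣ)) _ _ fun f => ?_).symm
  simp only [Equiv.curry_apply, Function.curry_apply, detFactor]
  ring

theorem IsGaussianMatrix.integrable_wishart {Ω : Type*} [MeasurableSpace Ω] {n M N : ℕ}
    {G : Ω → Matrix (Fin M) (Fin N) ℍ[ℝ]} {P : Measure Ω} [IsProbabilityMeasure P]
    (hG : IsGaussianMatrix G P)
    (D : Fin n → Matrix (Fin M) (Fin M) ℍ[ℝ]) (ι : SignedIdx n → Fin N) (η : SignedIdx n → ℤˣ) :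
    Integrable (fun ω => ∏ k : Fin n,
      qEntry (wishart (G ω) (D k) (ι (k, 1)) (ι (k, -1))) (η (k, 1)) (η (k, -1))) P := by
  simp only [prod_qEntry_wishart]
  exact integrable_finsetSum _ fun f _ => (hG.isGaussianFamily.integrable_polyEval _).const_mul _

theorem IsGaussianMatrix.integral_wishart {Ω : Type*} [MeasurableSpace Ω] {n M N : ℕ}
    {G : Ω → Matrix (Fin M) (Fin N) ℍ[ℝ]} {P : Measure Ω} [IsProbabilityMeasure P]
    (hG : IsGaussianMatrix G P) {r : SignedIdx n → ℕ} (hr : Function.Injective r)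
    (D : Fin n → Matrix (Fin M) (Fin M) ℍ[ℝ]) (ι : SignedIdx n → Fin N) (η : SignedIdx n → ℤˣ) :
    ∫ ω, ∏ k : Fin n,
      qEntry (wishart (G ω) (D k) (ι (k, 1)) (ι (k, -1))) (η (k, 1)) (η (k, -1)) ∂P =
    ∑ p ∈ matchings (Finset.univ : Finset (SignedIdx n)), (N : ℂ)⁻¹ ^ n *
      ∑ f : SignedIdx n → Fin M × ℤˣ, detFactor D f *
        ∏ x, if r x < r (p x) then pairWeight ι η f x (p x) else 1 := by
  simp only [prod_qEntry_wishart]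
  rw [integral_finsetSum _ fun f _ => (hG.isGaussianFamily.integrable_polyEval _).const_mul _]
  simp only [integral_const_mul, hG.integral_factors hr, Finset.mul_sum, mul_assoc]
  rw [Finset.sum_comm]

/-! ### Combinatorics of `PM(n)` -/

section Combinatorics

variable {n : ℕ}

@[simp] lemma sgn_delta (x : SignedIdx n) : sgn (delta n x) = -sgn x := rfl

@[simp] lemma delta_delta (x : SignedIdx n) : delta n (delta n x) = x := by
  simp [delta]

lemma delta_mul_delta : delta n * delta n = 1 := Equiv.ext delta_delta

lemma delta_inv : (delta n)⁻¹ = delta n := inv_eq_of_mul_eq_one_left delta_mul_delta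

lemma delta_ne (x : SignedIdx n) : delta n x ≠ x := fun h => by
  have h1 := congrArg sgn h
  rw [sgn_delta] at h1
  rcases intUnits_cases (sgn x) with h2 | h2 <;> rw [h2] at h1 <;> revert h1 <;> decide

lemma eq_or_eq_delta_of_fst_eq {x y : SignedIdx n} (h : x.1 = y.1) : y = x ∨ y = delta n x := by
  obtain ⟨k, s⟩ := x
  obtain ⟨l, t⟩ := y
  obtain rfl : k = l := h
  rcases intUnits_cases s with rfl | rfl <;> rcases intUnits_cases t with rfl | rfl <;>
    simp [delta]

lemma zpow_delta {π : Equiv.Perm (SignedIdx n)} (h : delta n * π * delta n = π⁻¹) (i : ℤ)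
    (x : SignedIdx n) : (π ^ i) (delta n x) = delta n ((π ^ (-i)) x) := by
  have h1 : delta n * π ^ i * delta n = π ^ (-i) := by
    have h2 := conj_zpow (a := delta n) (b := π) (i := i)
    rw [delta_inv, h, inv_zpow'] at h2
    exact h2.symm
  rw [← h1]
  simp [Equiv.Perm.mul_apply]

lemma mem_PM {π : Equiv.Perm (SignedIdx n)} :
    π ∈ PM n ↔ delta n * π * delta n = π⁻¹ ∧ ∀ k, ¬ π.SameCycle k (delta n k) := by
  simp [PM]

lemma delta_mul_eq {π : Equiv.Perm (SignedIdx n)} (h : π ∈ PM n) : delta n * π = π⁻¹ * delta n := by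
  rw [← (mem_PM.1 h).1, mul_assoc, delta_mul_delta, mul_one]

lemma inv_mem_PM {π : Equiv.Perm (SignedIdx n)} (h : π ∈ PM n) : π⁻¹ ∈ PM n := by
  rw [mem_PM]
  refine ⟨?_, fun k => ?_⟩
  · rw [inv_inv, ← (mem_PM.1 h).1]
    exact Equiv.ext fun x => by simp
  · rw [Equiv.Perm.sameCycle_inv]
    exact (mem_PM.1 h).2 k

/-- That `δπ` is an involution is the relation `δπδ = π⁻¹`. Given this, if `π^i k = -k`, then `π^r
k` is fixed by `δ` for `i = 2r` (impossible) and by `δπ` for `i = 2r + 1`; so absence of fixed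
points of `δπ` already separates `k` from `-k`. -/
lemma delta_mul_mem_matchings_iff {π : Equiv.Perm (SignedIdx n)} :
    delta n * π ∈ matchings Finset.univ ↔ π ∈ PM n := by
  rw [mem_matchings, mem_PM]
  simp only [Equiv.Perm.mul_apply, Finset.mem_univ, iff_true]
  constructor
  · rintro ⟨h1, h2⟩
    have h3 : delta n * π * delta n = π⁻¹ := by
      rw [eq_inv_iff_mul_eq_one]
      exact Equiv.ext h1
    refine ⟨h3, ?_⟩
    rintro k ⟨i, hi⟩
    rcases Int.even_or_odd' i with ⟨r, rfl | rfl⟩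
    · refine delta_ne ((π ^ r) k) ?_
      have h4 : (π ^ r) ((π ^ r) k) = (π ^ r) (delta n ((π ^ r) k)) := by
        rw [zpow_delta h3, ← Equiv.Perm.mul_apply, ← Equiv.Perm.mul_apply (π ^ (-r)), ← zpow_add,
          ← zpow_add, neg_add_cancel, zpow_zero, Equiv.Perm.one_apply, ← hi, two_mul]
      exact ((π ^ r).injective h4).symm
    · refine h2 ((π ^ r) k) ?_
      have h4 : (π ^ r) (π ((π ^ r) k)) = (π ^ r) (delta n ((π ^ r) k)) := by
        rw [zpow_delta h3, ← Equiv.Perm.mul_apply π, ← Equiv.Perm.mul_apply (π ^ r),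
          ← Equiv.Perm.mul_apply (π ^ (-r)), ← zpow_add, neg_add_cancel, zpow_zero,
          Equiv.Perm.one_apply, ← hi, ← zpow_one_add, ← zpow_add]
        congr 2
        ring
      rw [(π ^ r).injective h4, delta_delta]
  · rintro ⟨h1, h2⟩
    refine ⟨fun x => ?_, fun x hx => h2 x ⟨1, ?_⟩⟩
    · have h3 := congrArg (fun σ : Equiv.Perm (SignedIdx n) => σ (π x)) h1
      simpa [Equiv.Perm.mul_apply] using h3
    · rw [zpow_one, ← delta_delta (π x), hx]

lemma sum_matchings_eq_sum_PM {A : Type*} [AddCommMonoid A]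
    (F : Equiv.Perm (SignedIdx n) → A) :
    ∑ p ∈ matchings Finset.univ, F p = ∑ α ∈ PM n, F (delta n * α) := by
  refine Finset.sum_nbij' (fun p => delta n * p) (fun α => delta n * α) ?_ ?_ ?_ ?_ ?_
  · intro p hp
    rw [← delta_mul_mem_matchings_iff, ← mul_assoc, delta_mul_delta, one_mul]
    exact hp
  · intro α hα
    exact delta_mul_mem_matchings_iff.2 hα
  all_goals intro p _; simp only [← mul_assoc, delta_mul_delta, one_mul]

lemma sameCycle_delta {π : Equiv.Perm (SignedIdx n)} (h : π ∈ PM n) {x y : SignedIdx n} :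
    π.SameCycle (delta n x) (delta n y) ↔ π.SameCycle x y := by
  have key : ∀ x y, π.SameCycle x y → π.SameCycle (delta n x) (delta n y) := by
    rintro x y ⟨i, rfl⟩
    refine ⟨-i, ?_⟩
    rw [zpow_delta (mem_PM.1 h).1, neg_neg]
  refine ⟨fun hxy => ?_, key x y⟩
  simpa using key _ _ hxy

lemma mem_FD {π : Equiv.Perm (SignedIdx n)} {x : SignedIdx n} :
    x ∈ FD π ↔ ∃ j, π.SameCycle x j ∧ sgn j = 1 ∧ ∀ l, π.SameCycle x l → j.1 ≤ l.1 := by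
  simp [FD]

lemma FD_inv (π : Equiv.Perm (SignedIdx n)) : FD π⁻¹ = FD π := by
  ext x
  simp only [mem_FD, Equiv.Perm.sameCycle_inv]

/-- `δ` carries cycles to distinct mirror cycles, preserving absolute values and flipping the sign
of the smallest element; exactly one cycle of each mirror pair is selected. -/
lemma delta_mem_FD {π : Equiv.Perm (SignedIdx n)} (h : π ∈ PM n) (x : SignedIdx n) :
    delta n x ∈ FD π ↔ x ∉ FD π := by
  classical
  constructor
  · intro h1 h2
    obtain ⟨j, hj, hjs, hjm⟩ := mem_FD.1 h2
    obtain ⟨j', hj', hjs', hjm'⟩ := mem_FD.1 h1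
    have h3 : π.SameCycle x (delta n j') := by
      rw [← sameCycle_delta h, delta_delta]; exact hj'
    have h4 : j = j' := Prod.ext
      (le_antisymm (hjm (delta n j') h3) (hjm' (delta n j) ((sameCycle_delta h).2 hj))) (hjs.trans hjs'.symm)
    exact (mem_PM.1 h).2 x (hj.trans (h4 ▸ hj'.symm))
  · intro h1
    obtain ⟨j, hj, hjm⟩ := (Finset.univ.filter fun l => π.SameCycle x l).exists_min_image Prod.fst
      ⟨x, by simpa using Equiv.Perm.SameCycle.refl π x⟩
    simp only [Finset.mem_filter, Finset.mem_univ, true_and] at hj hjm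
    rcases intUnits_cases (sgn j) with hs | hs
    · exact absurd (mem_FD.2 ⟨j, hj, hs, hjm⟩) h1
    · refine mem_FD.2 ⟨delta n j, (sameCycle_delta h).2 hj, by simp [hs], fun l hl => ?_⟩
      have h3 : π.SameCycle x (delta n l) := by
        rw [← sameCycle_delta h, delta_delta]; exact hl
      exact hjm (delta n l) h3

/-- Thus `FD(π)` is a set of representatives for the pairs of the matching `πδ`. -/
lemma apply_delta_mem_FD {π : Equiv.Perm (SignedIdx n)} (h : π ∈ PM n) (x : SignedIdx n) :
    π (delta n x) ∈ FD π ↔ x ∉ FD π := by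
  rw [apply_mem_FD, delta_mem_FD h]

lemma apply_delta_apply_delta {π : Equiv.Perm (SignedIdx n)} (h : π ∈ PM n) (x : SignedIdx n) :
    π (delta n (π (delta n x))) = x := by
  have h3 := congrArg (fun σ : Equiv.Perm (SignedIdx n) => π (σ x)) (mem_PM.1 h).1
  simpa [Equiv.Perm.mul_apply] using h3

lemma numCycles_inv {α : Type*} (π : Equiv.Perm α) : numCycles π⁻¹ = numCycles π := by
  unfold numCycles
  congr 2
  ext x y
  exact Equiv.Perm.sameCycle_inv

/-- Half of the cycles of `π ∈ PM(n)` lie in `FD(π)`. -/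
lemma numCycles_eq_two_mul {π : Equiv.Perm (SignedIdx n)} (h : π ∈ PM n) :
    numCycles π = 2 * numCycles (FDPerm π) := by
  have hsub : ∀ x y : {k // k ∈ FD π}, (FDPerm π).SameCycle x y ↔ π.SameCycle x y := fun x y =>
    Equiv.Perm.sameCycle_subtypePerm
  -- The left copy embeds the cycles of `FD(π)`, the right copy their mirror images under `δ`.
  let F : Quotient (Equiv.Perm.SameCycle.setoid (FDPerm π)) ⊕
      Quotient (Equiv.Perm.SameCycle.setoid (FDPerm π)) →
      Quotient (Equiv.Perm.SameCycle.setoid π) :=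
    Sum.elim (Quotient.map (fun x => (x : SignedIdx n)) fun x y hxy => (hsub x y).1 hxy)
      (Quotient.map (fun x => delta n x) fun x y hxy => (sameCycle_delta h).2 ((hsub x y).1 hxy))
  have hmem : ∀ {x y}, π.SameCycle x y → (x ∈ FD π ↔ y ∈ FD π) := by
    rintro x y hxy
    simp only [mem_FD]
    refine exists_congr fun j => and_congr ⟨fun h => hxy.symm.trans h, fun h => hxy.trans h⟩
      (and_congr Iff.rfl (forall_congr' fun l => imp_congr
        ⟨fun h => hxy.symm.trans h, fun h => hxy.trans h⟩ Iff.rfl))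
  have hF : Function.Bijective F := by
    constructor
    · rintro (a | a) (b | b) hab
      all_goals
        induction a using Quotient.inductionOn with | _ x
        induction b using Quotient.inductionOn with | _ y
      · exact congrArg Sum.inl (Quotient.sound ((hsub x y).2 (Quotient.exact hab)))
      · have h1 : π.SameCycle x (delta n y) := Quotient.exact hab
        exact absurd y.2 ((delta_mem_FD h y).1 ((hmem h1).1 x.2))
      · have h1 : π.SameCycle (delta n x) y := Quotient.exact hab
        exact absurd x.2 ((delta_mem_FD h x).1 ((hmem h1).2 y.2))
      · have h1 : π.SameCycle (delta n x) (delta n y) := Quotient.exact hab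
        exact congrArg Sum.inr (Quotient.sound ((hsub x y).2 ((sameCycle_delta h).1 h1)))
    · intro q
      induction q using Quotient.inductionOn with | _ x
      by_cases hx : x ∈ FD π
      · exact ⟨Sum.inl (Quotient.mk _ ⟨x, hx⟩), rfl⟩
      · refine ⟨Sum.inr (Quotient.mk _ ⟨delta n x, (delta_mem_FD h x).2 hx⟩), ?_⟩
        change Quotient.mk _ (delta n (delta n x)) = _
        rw [delta_delta]
  unfold numCycles
  rw [← Nat.card_congr (Equiv.ofBijective F hF), Nat.card_sum, two_mul]

/-- Products over `[n]` as products over `FD(π)`. -/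
lemma prod_eq_prod_FD {π : Equiv.Perm (SignedIdx n)} (h : π ∈ PM n) (T : Fin n → ℂ) :
    ∏ k, T k = ∏ x : {k // k ∈ FD π}, T x.1.1 := by
  symm
  refine Fintype.prod_bijective (fun x : {k // k ∈ FD π} => x.1.1) ⟨?_, ?_⟩ _ _ fun _ => rfl
  · rintro ⟨x, hx⟩ ⟨y, hy⟩ hxy
    rcases eq_or_eq_delta_of_fst_eq hxy with h1 | h1
    · exact Subtype.ext h1.symm
    · exact absurd hx ((delta_mem_FD h x).1 (h1 ▸ hy))
  · intro k
    by_cases hk : (k, 1) ∈ FD π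
    · exact ⟨⟨(k, 1), hk⟩, rfl⟩
    · exact ⟨⟨delta n (k, 1), (delta_mem_FD h _).2 hk⟩, rfl⟩

lemma card_FD {π : Equiv.Perm (SignedIdx n)} (h : π ∈ PM n) :
    Fintype.card {k // k ∈ FD π} = n := by
  -- The product identity for the constant `2` compares `2 ^ n` with `2 ^ |FD(π)|`.
  have h1 := prod_eq_prod_FD h fun _ => (2 : ℂ)
  simp only [Finset.prod_const, Finset.card_univ, Fintype.card_fin] at h1
  have h2 : 2 ^ n = 2 ^ Fintype.card {k // k ∈ FD π} := by exact_mod_cast h1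
  exact (Nat.pow_right_injective le_rfl h2).symm

end Combinatorics

/-! ### Evaluation of the contribution of one pairing -/

section Contribution

variable {n M N : ℕ}

/-- The pairing-compatible choice of indices determined by its values on `FD(π)`. -/
noncomputable def extendFD {π : Equiv.Perm (SignedIdx n)} (hπ : π ∈ PM n)
    (g : {k // k ∈ FD π} → Fin M × ℤˣ) (x : SignedIdx n) : Fin M × ℤˣ :=
  if h : x ∈ FD π then ((g ⟨x, h⟩).1, sgn x * (g ⟨x, h⟩).2)
  else ((g ⟨π (delta n x), (apply_delta_mem_FD hπ x).2 h⟩).1,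
    -(sgn x * (g ⟨π (delta n x), (apply_delta_mem_FD hπ x).2 h⟩).2))

variable {π : Equiv.Perm (SignedIdx n)}

lemma extendFD_coe (hπ : π ∈ PM n) (g : {k // k ∈ FD π} → Fin M × ℤˣ) (x : {k // k ∈ FD π}) :
    extendFD hπ g x = ((g x).1, sgn x.1 * (g x).2) := by
  simp [extendFD, x.2]

lemma extendFD_delta (hπ : π ∈ PM n) (g : {k // k ∈ FD π} → Fin M × ℤˣ) (x : {k // k ∈ FD π}) :
    extendFD hπ g (delta n x) = ((g (FDPerm π x)).1, sgn x.1 * (g (FDPerm π x)).2) := by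
  have h1 : delta n x ∉ FD π := fun h => (delta_mem_FD hπ x).1 h x.2
  have h2 : ∀ h, (⟨π (delta n (delta n x)), h⟩ : {k // k ∈ FD π}) = FDPerm π x := fun h =>
    Subtype.ext (by simp [FDPerm])
  simp only [extendFD, h1, dif_neg, not_false_iff, h2, sgn_delta, neg_mul, neg_neg]

lemma extendFD_apply_delta (hπ : π ∈ PM n) (g : {k // k ∈ FD π} → Fin M × ℤˣ) (x : {k // k ∈ FD π}) :
    extendFD hπ g (π (delta n x)) = ((g x).1, -(sgn (π (delta n x)) * (g x).2)) := by
  have h1 : π (delta n x) ∉ FD π := fun h => (apply_delta_mem_FD hπ x).1 h x.2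
  have h2 : ∀ h, (⟨π (delta n (π (delta n x))), h⟩ : {k // k ∈ FD π}) = x := fun h =>
    Subtype.ext (apply_delta_apply_delta hπ x)
  simp only [extendFD, h1, dif_neg, not_false_iff, h2]

lemma extendFD_injective (hπ : π ∈ PM n) :
    Function.Injective (extendFD hπ : ({k // k ∈ FD π} → Fin M × ℤˣ) → _) := by
  intro g g' h
  ext1 x
  have h1 := congrFun h x
  rw [extendFD_coe, extendFD_coe, Prod.mk.injEq, mul_right_inj] at h1
  exact Prod.ext h1.1 h1.2

/-- The constraints for nonzero covariances determine `f` off `FD(π)` from its values on `FD(π)`. -/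
lemma mem_range_extendFD (hπ : π ∈ PM n) {f : SignedIdx n → Fin M × ℤˣ}
    (hf : ∀ x ∈ FD π, (f x).1 = (f (π (delta n x))).1 ∧
      sgn x * (f x).2 = -(sgn (π (delta n x)) * (f (π (delta n x))).2)) :
    f ∈ Set.range (extendFD hπ) := by
  refine ⟨fun x => ((f x).1, sgn x.1 * (f x).2), funext fun x => ?_⟩
  have hs : ∀ s t : ℤˣ, s * (s * t) = t := fun s t => by
    rw [← mul_assoc, Int.units_mul_self, one_mul]
  by_cases hx : x ∈ FD π
  · simp only [extendFD, hx, dif_pos, hs]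
  · have h1 := hf _ ((apply_delta_mem_FD hπ x).2 hx)
    rw [apply_delta_apply_delta hπ] at h1
    simp only [extendFD, hx, dif_neg, not_false_iff, h1, mul_neg, hs, neg_neg]

lemma signedMatrix_neg (D : Fin n → Matrix (Fin M) (Fin M) ℍ[ℝ]) (k : Fin n) (a b : Fin M) :
    signedMatrix D (k, -1) a b = star (D k b a) := by
  rw [signedMatrix, if_neg (by simp [sgn]), Matrix.conjTranspose_apply]

/-- The partner of `-x` is `π(x)`, so the two indices of the matrix at `x` are the values of `g` at
`x` and `π(x)`. For negative `x` they occur in reverse order with negated quaternionic indices,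
which `qEntry_star'` reads as an adjoint entry. -/
lemma detFactor_extendFD (hπ : π ∈ PM n) (D : Fin n → Matrix (Fin M) (Fin M) ℍ[ℝ])
    (g : {k // k ∈ FD π} → Fin M × ℤˣ) :
    detFactor D (extendFD hπ g) = ∏ x : {k // k ∈ FD π},
      (((if sgn x.1 = 1 then 1 else (g x).2 * (g (FDPerm π x)).2 : ℤˣ) : ℤ) : ℂ) *
        qEntry (signedMatrix D x (g x).1 (g (FDPerm π x)).1) (g x).2 (g (FDPerm π x)).2 := by
  rw [detFactor, prod_eq_prod_FD hπ]
  refine Finset.prod_congr rfl fun x _ => ?_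
  have h1 := extendFD_coe hπ g x
  have h2 := extendFD_delta hπ g x
  obtain ⟨⟨k, s⟩, hx⟩ := x
  rcases intUnits_cases s with rfl | rfl
  · have h3 : delta n (k, 1) = (k, -1) := rfl
    rw [h3] at h2
    simp only [h1, h2, sgn, signedMatrix, if_true, one_mul]
    simp
  · have h3 : delta n (k, -1) = (k, 1) := by simp [delta]
    rw [h3] at h2
    rw [h1, h2, signedMatrix_neg, qEntry_star', ← mul_assoc]
    simp only [sgn, neg_one_ne_one_units, if_false, neg_mul, one_mul]
    rw [← Int.cast_mul, ← Units.val_mul, Int.units_mul_self]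
    simp

/-- The signs attached to a pairing. -/
lemma prod_signs (hπ : π ∈ PM n) (η : SignedIdx n → ℤˣ)
    (hη : ∀ x, sgn x * η x = -(sgn (π (delta n x)) * η (π (delta n x))))
    (h : {k // k ∈ FD π} → ℤˣ) :
    (∏ x : {k // k ∈ FD π}, if sgn x.1 = 1 then 1 else h x * h (FDPerm π x)) *
      (∏ x : {k // k ∈ FD π}, if sgn x.1 = sgn (π (delta n x)) then sgn x.1 * h x * η x else 1) =
    ∏ x : {k // k ∈ FD π}, if sgn x.1 = 1 then 1 else η x * η (delta n x) := by
  set w : {k // k ∈ FD π} → ℤˣ := fun x => sgn x.1 * h x * η x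
  -- The partner of `π(x)` is `-x`, so after reindexing `w (π x)` occurs on the left when `x` and
  -- `π(x)` have different signs. On the right it occurs once for each of them that is negative; the
  -- parities agree and `w ^ 2 = 1`.
  have h1 : (∏ x : {k // k ∈ FD π},
      if sgn x.1 = sgn (π (delta n x)) then sgn x.1 * h x * η x else 1) =
      (∏ x : {k // k ∈ FD π}, if sgn x.1 = 1 then 1 else w x) *
        ∏ x : {k // k ∈ FD π}, if sgn x.1 = 1 then 1 else w (FDPerm π x) := by
    rw [← Equiv.prod_comp (FDPerm π), ← Equiv.prod_comp (FDPerm π) fun x =>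
      if sgn x.1 = 1 then 1 else w x, ← Finset.prod_mul_distrib]
    refine Finset.prod_congr rfl fun x _ => ?_
    have h2 : sgn (π (delta n (FDPerm π x).1)) = -sgn x.1 := by
      have h3 := apply_delta_apply_delta hπ (delta n x.1)
      rw [delta_delta] at h3
      change sgn (π (delta n (π x.1))) = _
      rw [h3, sgn_delta]
    rw [h2]
    change (if _ then w (FDPerm π x) else 1) = _
    generalize w (FDPerm π x) = u
    rcases intUnits_cases (sgn x.1) with hs | hs <;>
      rcases intUnits_cases (sgn (FDPerm π x).1) with hs' | hs' <;> rw [hs, hs'] <;>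
      rcases intUnits_cases u with rfl | rfl <;> decide
  rw [h1, ← Finset.prod_mul_distrib, ← Finset.prod_mul_distrib]
  refine Finset.prod_congr rfl fun x _ => ?_
  have h2 : sgn (FDPerm π x).1 * η (FDPerm π x) = sgn x.1 * η (delta n x) := by
    have h3 := hη (delta n x)
    rw [delta_delta, sgn_delta, neg_mul, neg_inj] at h3
    exact h3.symm
  split_ifs with hs
  · simp
  · have h3 : w (FDPerm π x) = h (FDPerm π x) * (sgn x.1 * η (delta n x)) := by
      rw [← h2]
      change sgn (FDPerm π x).1 * h (FDPerm π x) * η (FDPerm π x) = _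
      ac_rfl
    rw [h3]
    change h x * h (FDPerm π x) * (sgn x.1 * h x * η x * _) = _
    calc _ = (h x * h x) * (h (FDPerm π x) * h (FDPerm π x)) * (sgn x.1 * sgn x.1) *
          (η x * η (delta n x)) := by ac_rfl
      _ = _ := by simp only [Int.units_mul_self, one_mul]

lemma prod_filter_eq_prod_FD (hπ : π ∈ PM n) (η : SignedIdx n → ℤˣ) :
    ∏ k ∈ Finset.univ.filter (fun k : Fin n => ((k, -1) : SignedIdx n) ∈ FD π),
      (((η (k, 1) * η (k, -1) : ℤˣ) : ℤ) : ℂ) =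
    (((∏ x : {k // k ∈ FD π}, if sgn x.1 = 1 then 1 else η x * η (delta n x) : ℤˣ) : ℤ) : ℂ) := by
  rw [Finset.prod_filter, prod_eq_prod_FD hπ, Units.coe_prod, Int.cast_prod]
  refine Finset.prod_congr rfl fun x _ => ?_
  obtain ⟨⟨k, s⟩, hx⟩ := x
  rcases intUnits_cases s with rfl | rfl
  · have h1 : ((k, -1) : SignedIdx n) ∉ FD π := fun h => (delta_mem_FD hπ (k, 1)).1 h hx
    simp [sgn, h1]
  · simp [sgn, hx, delta, mul_comm]

lemma sum_detFactor_mul_pairWeight (hπ : π ∈ PM n) (D : Fin n → Matrix (Fin M) (Fin M) ℍ[ℝ])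
    (ι : SignedIdx n → Fin N) (η : SignedIdx n → ℤˣ) (hι : ∀ x, ι x = ι (π (delta n x)))
    (hη : ∀ x, sgn x * η x = -(sgn (π (delta n x)) * η (π (delta n x)))) :
    ∑ f : SignedIdx n → Fin M × ℤˣ,
      detFactor D f * ∏ x : {k // k ∈ FD π}, pairWeight ι η f x (π (delta n x)) =
    (2 : ℂ)⁻¹ ^ n * (∏ k ∈ Finset.univ.filter (fun k : Fin n => ((k, -1) : SignedIdx n) ∈ FD π),
      (((η (k, 1) * η (k, -1) : ℤˣ) : ℤ) : ℂ)) *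
    ∑ i : {k // k ∈ FD π} → Fin M, ∑ h : {k // k ∈ FD π} → ℤˣ, ∏ k : {k // k ∈ FD π},
        qEntry (signedMatrix D k (i k) (i (FDPerm π k))) (h k) (h (FDPerm π k)) := by
  -- Choices of `f` outside the range of `extendFD` have a vanishing covariance and drop out.
  rw [← Fintype.sum_of_injective (extendFD hπ) (extendFD_injective hπ)
    (fun g => detFactor D (extendFD hπ g) *
      ∏ x : {k // k ∈ FD π}, pairWeight ι η (extendFD hπ g) x (π (delta n x)))]
  rotate_left
  · intro f hf
    by_contra hne
    refine hf (mem_range_extendFD hπ fun x hx => ?_)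
    have h1 := Finset.prod_ne_zero_iff.1 (right_ne_zero_of_mul hne) ⟨x, hx⟩ (Finset.mem_univ _)
    rw [pairWeight, ite_ne_right_iff] at h1
    exact ⟨h1.1.1.1, h1.1.2.1⟩
  · intro g
    rfl
  rw [← Fintype.sum_prod_type', Finset.mul_sum]
  refine Fintype.sum_equiv (Equiv.arrowProdEquivProdArrow _ _ _) _ _ fun g => ?_
  have h1 : ∀ x : {k // k ∈ FD π}, pairWeight ι η (extendFD hπ g) x (π (delta n x)) = (2 : ℂ)⁻¹ *
      (((if sgn x.1 = sgn (π (delta n x)) then sgn x.1 * (g x).2 * η x else 1 : ℤˣ) : ℤ) : ℂ) := by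
    intro x
    rw [pairWeight, if_pos]
    · rw [extendFD_coe]
      split_ifs <;> simp
    · rw [extendFD_coe, extendFD_apply_delta]
      refine ⟨⟨rfl, hι x⟩, ?_, hη x⟩
      simp only [mul_neg, neg_neg, ← mul_assoc, Int.units_mul_self]
  simp only [h1, detFactor_extendFD, Finset.prod_mul_distrib]
  rw [prod_filter_eq_prod_FD hπ, ← prod_signs hπ η hη fun x => (g x).2]
  rw [Finset.prod_const, Finset.card_univ, card_FD hπ]
  simp only [Equiv.arrowProdEquivProdArrow_apply, Units.val_mul, Units.coe_prod, Int.cast_mul,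
    Int.cast_prod]
  ring

lemma prod_pairWeight_eq_zero (hπ : π ∈ PM n) (ι : SignedIdx n → Fin N) (η : SignedIdx n → ℤˣ)
    (f : SignedIdx n → Fin M × ℤˣ)
    (h : ¬ ∀ x, ι x = ι (π (delta n x)) ∧
      sgn x * η x = -(sgn (π (delta n x)) * η (π (delta n x)))) :
    ∏ x : {k // k ∈ FD π}, pairWeight ι η f x (π (delta n x)) = 0 := by
  by_contra hne
  refine h fun x => ?_
  have h1 : ∀ x ∈ FD π, ι x = ι (π (delta n x)) ∧
      sgn x * η x = -(sgn (π (delta n x)) * η (π (delta n x))) := fun x hx => by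
    have h1 := Finset.prod_ne_zero_iff.1 hne ⟨x, hx⟩ (Finset.mem_univ _)
    rw [pairWeight, ite_ne_right_iff] at h1
    exact ⟨h1.1.1.2, h1.1.2.2⟩
  by_cases hx : x ∈ FD π
  · exact h1 x hx
  · have h2 := h1 _ ((apply_delta_mem_FD hπ x).2 hx)
    rw [apply_delta_apply_delta hπ] at h2
    exact ⟨h2.1.symm, by rw [h2.2, neg_neg]⟩

/-- Lower-ranked points and `FD(π)` are two systems of representatives of the same pairs, so the
auxiliary ranking disappears. -/
lemma prod_pairs_eq_prod_FD (hπ : π ∈ PM n) {r : SignedIdx n → ℕ} (hr : Function.Injective r)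
    (ι : SignedIdx n → Fin N) (η : SignedIdx n → ℤˣ) (f : SignedIdx n → Fin M × ℤˣ)
    {p : Equiv.Perm (SignedIdx n)} (hp : p = π * delta n) :
    (∏ x, if r x < r (p x) then pairWeight ι η f x (p x) else 1) =
      ∏ x : {k // k ∈ FD π}, pairWeight ι η f x (π (delta n x)) := by
  have hpx : ∀ x, p x = π (delta n x) := fun x => by rw [hp, Equiv.Perm.mul_apply]
  have hpp : ∀ x, p (p x) = x := fun x => by
    rw [hpx, hpx, apply_delta_apply_delta hπ]
  have hne : ∀ x, p x ≠ x := fun x h => by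
    have := apply_delta_mem_FD hπ x
    rw [← hpx, h] at this
    tauto
  rw [← Finset.prod_filter, prod_transversal_eq hpp (R' := FD π)
    (f := fun x => pairWeight ι η f x (p x)), ← Finset.prod_coe_sort]
  · simp only [hpx]
  · intro x
    rw [hpp, pairWeight_comm]
  · intro x
    simp only [Finset.mem_filter, Finset.mem_univ, true_and, hpp, not_lt]
    exact ⟨le_of_lt, fun h => lt_of_le_of_ne h fun h' => hne x (hr h')⟩
  · intro x
    rw [hpx]
    exact apply_delta_mem_FD hπ x

end Contribution

end QWishart

/-! ### Assembly of the moment formula -/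

open QWishart in
/-- Every `α ∈ PM(n)` has an even number of cycles, so the integer division by `2` is exact. -/
theorem mainTheorem7 {Ω : Type*} [MeasurableSpace Ω] (P : MeasureTheory.Measure Ω)
    [MeasureTheory.IsProbabilityMeasure P] (n M N : ℕ)
    (G : Ω → Matrix (Fin M) (Fin N) ℍ[ℝ]) (hG : QWishart.IsGaussianMatrix G P)
    (D : Fin n → Matrix (Fin M) (Fin M) ℍ[ℝ])
    (ι : QWishart.SignedIdx n → Fin N) (η : QWishart.SignedIdx n → ℤˣ) :
    MeasureTheory.Integrable (fun ω => ∏ k : Fin n,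
      QWishart.qEntry (QWishart.wishart (G ω) (D k) (ι (k, 1)) (ι (k, -1)))
        (η (k, 1)) (η (k, -1))) P ∧
    ∫ ω, ∏ k : Fin n,
      QWishart.qEntry (QWishart.wishart (G ω) (D k) (ι (k, 1)) (ι (k, -1)))
        (η (k, 1)) (η (k, -1)) ∂P =
      ∑ α ∈ (QWishart.PM n).filter (fun α =>
          (∀ k, ι k = ι (QWishart.delta n (α k))) ∧
          (∀ k, QWishart.sgn k * η k = QWishart.sgn (α k) * η (QWishart.delta n (α k)))),
        (2 * (N : ℂ)) ^ ((QWishart.numCycles α : ℤ) / 2 - (n : ℤ)) *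
          (∏ k ∈ Finset.univ.filter (fun k : Fin n => ((k, -1) : QWishart.SignedIdx n) ∈ QWishart.FD α),
            (((η (k, 1) * η (k, -1) : ℤˣ) : ℤ) : ℂ)) *
          QWishart.wishartCumulant N D α := by
  refine ⟨hG.integrable_wishart D ι η, ?_⟩
  obtain ⟨r, hr⟩ : ∃ r : SignedIdx n → ℕ, Function.Injective r :=
    ⟨_, Fin.val_injective.comp (Fintype.equivFin (SignedIdx n)).injective⟩
  rw [hG.integral_wishart hr, sum_matchings_eq_sum_PM, Finset.sum_filter]
  refine Finset.sum_congr rfl fun α hα => ?_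
  have hβ := inv_mem_PM hα
  have hpx : ∀ x, delta n (α x) = α⁻¹ (delta n x) := fun x =>
    congrArg (fun σ : Equiv.Perm (SignedIdx n) => σ x) (delta_mul_eq hα)
  simp only [prod_pairs_eq_prod_FD hβ hr ι η _ (delta_mul_eq hα)]
  have hcond : ((∀ k, ι k = ι (delta n (α k))) ∧
      (∀ k, sgn k * η k = sgn (α k) * η (delta n (α k)))) ↔
      ∀ x, ι x = ι (α⁻¹ (delta n x)) ∧
        sgn x * η x = -(sgn (α⁻¹ (delta n x)) * η (α⁻¹ (delta n x))) := by
    rw [← forall_and]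
    refine forall_congr' fun x => ?_
    rw [← hpx, sgn_delta, neg_mul, neg_neg]
  by_cases hC : ∀ x, ι x = ι (α⁻¹ (delta n x)) ∧
      sgn x * η x = -(sgn (α⁻¹ (delta n x)) * η (α⁻¹ (delta n x)))
  · rw [if_pos (hcond.2 hC), sum_detFactor_mul_pairWeight hβ D ι η (fun x => (hC x).1)
      (fun x => (hC x).2), wishartCumulant, reTr]
    have hFD : ∏ k ∈ Finset.univ.filter (fun k : Fin n => ((k, -1) : SignedIdx n) ∈ FD α),
        (((η (k, 1) * η (k, -1) : ℤˣ) : ℤ) : ℂ) =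
        ∏ k ∈ Finset.univ.filter (fun k : Fin n => ((k, -1) : SignedIdx n) ∈ FD α⁻¹),
        (((η (k, 1) * η (k, -1) : ℤˣ) : ℤ) : ℂ) := by rw [FD_inv]
    have hc := numCycles_eq_two_mul hβ
    rw [numCycles_inv] at hc
    have hdiv : ((numCycles α : ℤ) / 2) = (numCycles (FDPerm α⁻¹) : ℤ) := by omega
    -- If `n > 0`, a value of `ι` witnesses `N > 0`. Otherwise all exponents are zero, so `N = 0`
    -- causes no trouble.
    have hN : (N : ℂ) ≠ 0 ∨ n = 0 ∧ numCycles (FDPerm α⁻¹) = 0 := by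
      rcases Nat.eq_zero_or_pos n with rfl | hn
      · right
        refine ⟨rfl, ?_⟩
        have : numCycles α = 0 := by simp [numCycles]
        omega
      · left
        have := (ι (⟨0, hn⟩, 1)).pos
        exact_mod_cast this.ne'
    have hscalar : (N : ℂ)⁻¹ ^ n * (2 : ℂ)⁻¹ ^ n =
        (2 * (N : ℂ)) ^ ((numCycles (FDPerm α⁻¹) : ℤ) - n) *
          (((2 : ℂ) ^ numCycles (FDPerm α⁻¹))⁻¹ * ((N : ℂ) ^ numCycles (FDPerm α⁻¹))⁻¹) := by
      rcases hN with hN | ⟨rfl, hc0⟩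
      · rw [zpow_sub₀ (by simpa using hN), zpow_natCast, zpow_natCast, mul_pow, mul_pow, inv_pow,
          inv_pow]
        field_simp
      · simp [hc0]
    rw [hdiv, hFD, ← mul_assoc, ← mul_assoc, hscalar]
    ring
  · rw [if_neg fun h => hC (hcond.1 h), Finset.sum_eq_zero fun f _ => by
      rw [prod_pairWeight_eq_zero hβ ι η f hC, mul_zero], mul_zero]
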